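/- Let $i_1,\dots,i_l$ be distinct real numbers with $1+i_t>0$ for all $t$, and let $(I_n)_{n\ge0}$ be a time-homogeneous Markov chain on $\{i_1,\dots,i_l\}$ with transition probabilities $p_{st}=\Pr(I_{n+1}=i_t\mid I_n=i_s)$ (the interest rates). Let $Z_1,Z_2,\dots$ be i.i.d. nonnegative random variables (the losses), independent of $(I_n)_{n\ge0}$, with finite mean $\mu$ and distribution function $W$. Suppose that $W$ has a regularly varying tail, $W\in\mathcal R_{-\alpha}$ for some $\alpha>0$; that is, with $\bar W=1-W$, $$\lim_{x\to\infty}\frac{\bar W(xy)}{\bar W(x)}=y^{-\alpha}\qquad\text{for every } y>0.$$ Let $b\in(0,1]$ be the retention level of a proportional reinsurance, so that the insurer retains the part $bZ_n$ of the loss $Z_n$, let $\bar V(x)=\Pr(bZ_1>x)$, and let $c(b)=(1+\eta)\,b\mu-(\eta-\theta)\mu$ be the retained premium, where $\theta,\eta$ are the loading factors of the insurer and of the reinsurer. For an initial capital $u$ define the surplus process by $U_0^b=u$ and $U_n^b=U_{n-1}^b(1+I_n)+c(b)-bZ_n$ for $n\ge1$, and for a state $i_s$ with $\Pr(I_0=i_s)>0$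 let $$\Psi_n^b(u,i_s)=\Pr\bigl(U_k^b<0\text{ for some }1\le k\le n\,\big|\,U_0^b=u,\ I_0=i_s\bigr).$$ Then for every $n$ and every such $i_s$ $$\Psi_n^b(u,i_s)\sim c_n(i_s)\,\bar V(u)\qquad\text{as } u\to\infty,$$ where $c_0=0$ and, for $n\ge1$ and every state $i_s$, $$c_n(i_s)=\mathrm E\bigl[(1+c_{n-1}(I_1))(1+I_1)^{-\alpha}\,\big|\,I_0=i_s\bigr]=\sum_{t=1}^l p_{st}\,(1+c_{n-1}(i_t))(1+i_t)^{-\alpha}.$$ -/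

import Mathlib

open MeasureTheory ProbabilityTheory Filter Topology

noncomputable section

namespace RiskProcess

/-- The tail `F̄ x = 1 - F x` of a distribution `F` on the real line. -/
def tail (F : Measure ℝ) (x : ℝ) : ℝ := F.real (Set.Ioi x)

/-- `F ∈ R_{-α}`: the distribution `F` has a regularly varying tail with index `-α`. -/
def HasRegularlyVaryingTail (F : Measure ℝ) (α : ℝ) : Prop :=
  ∀ y : ℝ, 0 < y → Tendsto (fun x : ℝ => tail F (x * y) / tail F x) atTop (𝓝 (y ^ (-α)))

/-- Under `P`, the sequence `I 0, I 1, …` is a time-homogeneous Markov chain with the finitely many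
(distinct) states `i 0, …, i (l-1)` and the transition probabilities `p s t`; its initial
distribution is arbitrary. The last field is
`P(I (n+1) = i t | I 0 = i (s 0), …, I n = i (s n)) = p (s n) t`, multiplied by the probability
of the conditioning event. -/
structure IsMarkovChain {Ω : Type*} [MeasurableSpace Ω] (P : Measure Ω) {l : ℕ}
    (i : Fin l → ℝ) (p : Fin l → Fin l → ℝ) (I : ℕ → Ω → ℝ) : Prop where
  injective : Function.Injective i
  nonneg : ∀ s t, 0 ≤ p s t
  sum_eq_one : ∀ s, ∑ t, p s t = 1
  measurable : ∀ n, Measurable (I n)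
  mem_range : ∀ n, ∀ᵐ ω ∂P, I n ω ∈ Set.range i
  markov : ∀ (n : ℕ) (s : ℕ → Fin l),
    P.real {ω | ∀ k ≤ n + 1, I k ω = i (s k)} =
      P.real {ω | ∀ k ≤ n, I k ω = i (s k)} * p (s n) (s (n + 1))

/-- Under `P`, the losses are independent and nonnegative with the common distribution `W`.
Here `Z k` is the total loss in the period `(k, k+1]`, which is the loss number `k + 1`. -/
structure IsLossSequence {Ω : Type*} [MeasurableSpace Ω] (P : Measure Ω)
    (W : Measure ℝ) (Z : ℕ → Ω → ℝ) : Prop where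
  measurable : ∀ k, Measurable (Z k)
  nonneg : ∀ k, ∀ᵐ ω ∂P, 0 ≤ Z k ω
  law : ∀ k, P.map (Z k) = W
  indep : iIndepFun Z P

/-- The part `h(x, b) = b x` of a loss `x` retained under proportional reinsurance. -/
def proportional (b x : ℝ) : ℝ := b * x

/-- The premium rate retained by the insurer,
`c(b) = (1 + η) E h(Z, b) - (η - θ) E Z`, where `Z` has distribution `W` and `h = h(·, b)`. -/
def retainedPremium (θ η : ℝ) (h : ℝ → ℝ) (W : Measure ℝ) : ℝ :=
  (1 + η) * (∫ z, h z ∂W) - (η - θ) * ∫ z, z ∂W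

/-- The surplus `U 0 = u`, `U (k+1) = U k * (1 + I (k+1)) + c - h (loss in (k, k+1])`
along a path of interest rates `I` and of losses `Z` (with `Z k` the loss in `(k, k+1]`). -/
def surplus (h : ℝ → ℝ) (c u : ℝ) (I Z : ℕ → ℝ) : ℕ → ℝ
  | 0 => u
  | k + 1 => surplus h c u I Z k * (1 + I (k + 1)) + c - h (Z k)

/-- The finite time ruin probability `Ψ_n(u, x) = P(U k < 0 for some 1 ≤ k ≤ n | U 0 = u, I 0 = x)`. -/
def ruinProb {Ω : Type*} [MeasurableSpace Ω] (P : Measure Ω) (I Z : ℕ → Ω → ℝ)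
    (h : ℝ → ℝ) (c : ℝ) (n : ℕ) (u x : ℝ) : ℝ :=
  (P[|{ω | I 0 ω = x}]).real
    {ω | ∃ k, 1 ≤ k ∧ k ≤ n ∧ surplus h c u (fun m => I m ω) (fun m => Z m ω) k < 0}

/-- The constants `c_0 = 0`, `c_n(i_s) = E[(1 + c_{n-1}(I_1)) (1 + I_1)^{-α} | I_0 = i_s]`. The
conditional law of `I_1` given `I_0 = i_s` is the row `p s` of the transition matrix, so that the
conditional expectation is defined for every state, whatever the initial distribution. -/
def asympConst {l : ℕ} (i : Fin l → ℝ) (p : Fin l → Fin l → ℝ) (α : ℝ) : ℕ → Fin l → ℝ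
  | 0, _ => 0
  | n + 1, s => ∑ t, p s t * ((1 + asympConst i p α n t) * (1 / (1 + i t)) ^ α)

end RiskProcess

end

/-!
For a fixed path of interest rates the surplus is affine in the losses. After discounting, ruin
within `n` periods means that at some time a weighted sum of the retained losses exceeds the
initial capital `u` up to a bounded premium term. As the losses are nonnegative, this event is
squeezed between two events in which the total discounted loss over all `n` periods exceeds `u ± C`,
for a constant `C` (`tendsto_ruinSet`). A regularly varying tail is insensitive to such shifts
(`HasRegularlyVaryingTail.tendsto_tail_add`), and a weighted sum of independent losses has the tail
of its largest term: `P(∑ d k * X k > u) ~ (∑ d k ^ α) * P(X 0 > u)`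
(`HasRegularlyVaryingTail.tendsto_sum`).

As there are only finitely many paths of rates up to time `n` and the rates are independent of the
losses, it remains to average `∑ d k ^ α` over the paths. This is done by forgetting the known rates
one at a time, the last one first (`tendsto_pathEvent_inter_ruinSet`): averaging over the next state
with the Markov property is the recursion that defines `asympConst`. When only the initial state is
left, the claim follows on dividing by its probability.
-/

namespace RiskProcess

open Set

/-! ### Regularly varying tails -/

lemma tail_antitone (F : Measure ℝ) [IsFiniteMeasure F] : Antitone (tail F) :=
  fun _ _ h => measureReal_mono (Ioi_subset_Ioi h)

lemma tail_tendsto_zero (F : Measure ℝ) [IsProbabilityMeasure F] :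
    Tendsto (tail F) atTop (𝓝 0) := by
  have h : tail F = fun x => 1 - cdf F x := by
    funext x
    rw [cdf_eq_real, tail, ← compl_Iic, probReal_compl_eq_one_sub measurableSet_Iic]
  rw [h]
  simpa using (tendsto_cdf_atTop F).const_sub 1

lemma HasRegularlyVaryingTail.tail_pos {F : Measure ℝ} [IsFiniteMeasure F] {α : ℝ}
    (h : HasRegularlyVaryingTail F α) (x : ℝ) : 0 < tail F x := by
  refine lt_of_le_of_ne measureReal_nonneg fun h0 => ?_
  -- a tail that vanishes at `x` vanishes beyond `x`, and then the quotients are `0 / 0 = 0`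
  have h1 := h 1 one_pos
  have h2 : Tendsto (fun x : ℝ => tail F (x * 1) / tail F x) atTop (𝓝 0) := by
    refine tendsto_const_nhds.congr' ?_
    filter_upwards [eventually_ge_atTop x] with y hy
    have : tail F y = 0 :=
      le_antisymm ((tail_antitone F hy).trans h0.symm.le) measureReal_nonneg
    simp [this]
  have := tendsto_nhds_unique h1 h2
  simp at this

lemma tail_map_proportional (W : Measure ℝ) {b : ℝ} (hb : 0 < b) (x : ℝ) :
    tail (W.map (proportional b)) x = tail W (x / b) := by
  unfold tail
  rw [map_measureReal_apply (by unfold proportional; fun_prop) measurableSet_Ioi]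
  congr 1
  ext z
  simp [proportional, div_lt_iff₀ hb, mul_comm]

lemma HasRegularlyVaryingTail.map_proportional {W : Measure ℝ} {α b : ℝ}
    (h : HasRegularlyVaryingTail W α) (hb : 0 < b) :
    HasRegularlyVaryingTail (W.map (proportional b)) α := by
  intro y hy
  refine ((h y hy).comp (tendsto_id.atTop_div_const hb)).congr fun x => ?_
  simp [tail_map_proportional W hb, div_mul_eq_mul_div]

/-- A regularly varying tail is long-tailed: it is squeezed between its values at `u * y` for
`y` close to `1`. -/
lemma HasRegularlyVaryingTail.tendsto_tail_add {F : Measure ℝ} [IsFiniteMeasure F] {α : ℝ}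
    (h : HasRegularlyVaryingTail F α) (C : ℝ) :
    Tendsto (fun u => tail F (u + C) / tail F u) atTop (𝓝 1) := by
  have hc : Tendsto (fun y : ℝ => y ^ (-α)) (𝓝 1) (𝓝 1) := by
    simpa using (Real.continuousAt_rpow_const 1 (-α) (Or.inl one_ne_zero)).tendsto
  rw [tendsto_order]
  constructor
  · intro a ha
    obtain ⟨y, hya, hy⟩ := ((hc.mono_left nhdsWithin_le_nhds).eventually (lt_mem_nhds ha)
      |>.and (self_mem_nhdsWithin (s := Ioi (1 : ℝ)))).exists
    have hy' : (1 : ℝ) < y := hy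
    filter_upwards [(h y (by linarith)).eventually (lt_mem_nhds hya),
      eventually_ge_atTop (C / (y - 1))] with u hu huC
    refine hu.trans_le (div_le_div_of_nonneg_right (tail_antitone F ?_) (h.tail_pos u).le)
    rw [div_le_iff₀ (by linarith)] at huC
    linarith
  · intro a ha
    obtain ⟨y, ⟨hya, hy0⟩, hy⟩ := (((hc.mono_left nhdsWithin_le_nhds).eventually (gt_mem_nhds ha)
      |>.and (nhdsWithin_le_nhds (lt_mem_nhds one_pos))).and
        (self_mem_nhdsWithin (s := Iio (1 : ℝ)))).exists
    have hy' : y < 1 := hy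
    filter_upwards [(h y hy0).eventually (gt_mem_nhds hya),
      eventually_ge_atTop (-C / (1 - y))] with u hu huC
    refine lt_of_le_of_lt (div_le_div_of_nonneg_right (tail_antitone F ?_) (h.tail_pos u).le) hu
    rw [div_le_iff₀ (by linarith)] at huC
    linarith

section TailAsymptotics

variable {Ω : Type*} [MeasurableSpace Ω] {P : Measure Ω} {F : Measure ℝ} {α : ℝ}

lemma HasRegularlyVaryingTail.tendsto_shift [IsFiniteMeasure F]
    (h : HasRegularlyVaryingTail F α) {f : ℝ → ℝ} {a : ℝ}
    (hf : Tendsto (fun u => f u / tail F u) atTop (𝓝 a)) (C : ℝ) :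
    Tendsto (fun u => f (u + C) / tail F u) atTop (𝓝 a) := by
  have h1 := (hf.comp (tendsto_atTop_add_const_right _ C tendsto_id)).mul (h.tendsto_tail_add C)
  rw [mul_one] at h1
  refine h1.congr fun u => ?_
  have := (h.tail_pos (u + C)).ne'
  simp only [Function.comp, id]
  field_simp

lemma HasRegularlyVaryingTail.tendsto_scale [IsFiniteMeasure F]
    (h : HasRegularlyVaryingTail F α) {f : ℝ → ℝ} {a : ℝ}
    (hf : Tendsto (fun u => f u / tail F u) atTop (𝓝 a)) {y : ℝ} (hy : 0 < y) :
    Tendsto (fun u => f (u * y) / tail F u) atTop (𝓝 (a * y ^ (-α))) := by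
  refine ((hf.comp (tendsto_id.atTop_mul_const hy)).mul (h y hy)).congr fun u => ?_
  have := (h.tail_pos (u * y)).ne'
  simp only [Function.comp, id]
  field_simp

/-- The tail of a sum of independent nonnegative variables is asymptotically the sum of the tails.
The sum exceeds `u` essentially only if one summand does: both summands exceed `ε u` with a
probability that is of second order. -/
lemma HasRegularlyVaryingTail.tendsto_add [IsProbabilityMeasure F] [IsProbabilityMeasure P]
    (h : HasRegularlyVaryingTail F α) {X Y : Ω → ℝ} (hX : Measurable X) (hY : Measurable Y)
    (hX0 : ∀ᵐ ω ∂P, 0 ≤ X ω) (hY0 : ∀ᵐ ω ∂P, 0 ≤ Y ω) (hXY : IndepFun X Y P) {a a' : ℝ}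
    (ha : Tendsto (fun u => P.real {ω | u < X ω} / tail F u) atTop (𝓝 a))
    (ha' : Tendsto (fun u => P.real {ω | u < Y ω} / tail F u) atTop (𝓝 a')) :
    Tendsto (fun u => P.real {ω | u < X ω + Y ω} / tail F u) atTop (𝓝 (a + a')) := by
  have hind : ∀ u, P.real {ω | u < X ω ∧ u < Y ω} =
      P.real {ω | u < X ω} * P.real {ω | u < Y ω} := fun u => by
    have := hXY.measure_inter_preimage_eq_mul (Ioi u) (Ioi u) measurableSet_Ioi measurableSet_Ioi
    have := congrArg ENNReal.toReal this
    rwa [ENNReal.toReal_mul] at this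
  have hY' : Tendsto (fun u => P.real {ω | u < Y ω}) atTop (𝓝 0) := by
    have := ha'.mul (tail_tendsto_zero F)
    rw [mul_zero] at this
    refine this.congr fun u => div_mul_cancel₀ _ (h.tail_pos u).ne'
  have hboth : Tendsto (fun u => P.real {ω | u < X ω ∧ u < Y ω} / tail F u) atTop (𝓝 0) := by
    have := ha.mul hY'
    rw [mul_zero] at this
    refine this.congr fun u => ?_
    rw [hind]
    ring
  have mY : ∀ u, MeasurableSet {ω | u < Y ω} := fun u => measurableSet_lt measurable_const hY
  rw [tendsto_order]
  constructor
  · intro q hq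
    have hlow := (ha.add ha').sub hboth
    rw [sub_zero] at hlow
    filter_upwards [hlow.eventually (lt_mem_nhds hq), eventually_ge_atTop 0] with u hu hu0
    refine hu.trans_le ?_
    rw [← add_div, ← sub_div]
    refine div_le_div_of_nonneg_right ?_ (h.tail_pos u).le
    have h1 := measureReal_union_add_inter (μ := P) (s := {ω | u < X ω}) (mY u)
    have h2 : P.real ({ω | u < X ω} ∪ {ω | u < Y ω}) ≤ P.real {ω | u < X ω + Y ω} := by
      refine ENNReal.toReal_mono (measure_ne_top _ _) (measure_mono_ae ?_)
      filter_upwards [hX0, hY0] with ω h1 h2 h3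
      rcases h3 with h3 | h3
      · exact lt_of_lt_of_le h3 (by linarith)
      · exact lt_of_lt_of_le h3 (by linarith)
    have h3 : {ω | u < X ω} ∩ {ω | u < Y ω} = {ω | u < X ω ∧ u < Y ω} := rfl
    rw [h3] at h1
    linarith
  · intro q hq
    have hc : Tendsto (fun y : ℝ => (a + a') * y ^ (-α)) (𝓝 1) (𝓝 (a + a')) := by
      simpa using ((Real.continuousAt_rpow_const 1 (-α) (Or.inl one_ne_zero)).tendsto).const_mul
        (a + a')
    -- `y = 1 - ε`
    obtain ⟨y, ⟨hya, hy0⟩, hy⟩ := (((hc.mono_left nhdsWithin_le_nhds).eventually (gt_mem_nhds hq)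
      |>.and (nhdsWithin_le_nhds (lt_mem_nhds one_pos))).and
        (self_mem_nhdsWithin (s := Iio (1 : ℝ)))).exists
    have hy' : 0 < 1 - y := sub_pos.2 hy
    have hup := ((h.tendsto_scale ha hy0).add (h.tendsto_scale ha' hy0)).add
      (h.tendsto_scale hboth hy')
    rw [zero_mul, add_zero, ← add_mul] at hup
    filter_upwards [hup.eventually (gt_mem_nhds hya)] with u hu
    refine lt_of_le_of_lt ?_ hu
    rw [← add_div, ← add_div]
    refine div_le_div_of_nonneg_right ?_ (h.tail_pos u).le
    refine (measureReal_mono (s₂ := ({ω | u * y < X ω} ∪ {ω | u * y < Y ω}) ∪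
      {ω | u * (1 - y) < X ω ∧ u * (1 - y) < Y ω}) ?_).trans
      ((measureReal_union_le _ _).trans (add_le_add_left (measureReal_union_le _ _) _))
    intro ω hω
    simp only [mem_ofPred_eq, mem_union] at hω ⊢
    by_contra! hcon
    obtain ⟨⟨h1, h2⟩, h3⟩ := hcon
    have h4 := h3 (by linarith)
    linarith

/-- A weighted sum of independent nonnegative variables with a common regularly varying tail. -/
lemma HasRegularlyVaryingTail.tendsto_sum [IsProbabilityMeasure F] [IsProbabilityMeasure P]
    (h : HasRegularlyVaryingTail F α) {X : ℕ → Ω → ℝ} (hX : ∀ k, Measurable (X k))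
    (hX0 : ∀ k, ∀ᵐ ω ∂P, 0 ≤ X k ω) (hlaw : ∀ k, P.map (X k) = F) (hind : iIndepFun X P)
    {d : ℕ → ℝ} (hd : ∀ k, 0 < d k) (n : ℕ) :
    Tendsto (fun u => P.real {ω | u < ∑ k ∈ Finset.range n, d k * X k ω} / tail F u) atTop
      (𝓝 (∑ k ∈ Finset.range n, d k ^ α)) := by
  induction n with
  | zero =>
    refine tendsto_const_nhds.congr' ?_
    filter_upwards [eventually_ge_atTop 0] with u hu
    simp [not_lt.2 hu]
  | succ n ih =>
    simp only [Finset.sum_range_succ]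
    have hm : ∀ k, Measurable fun ω => d k * X k ω := fun k => (hX k).const_mul _
    refine h.tendsto_add (Finset.measurable_fun_sum _ fun k _ => hm k) (hm n) ?_ ?_ ?_ ih ?_
    · filter_upwards [ae_all_iff.2 hX0] with ω hω
      exact Finset.sum_nonneg fun k _ => mul_nonneg (hd k).le (hω k)
    · filter_upwards [hX0 n] with ω hω using mul_nonneg (hd n).le hω
    · have h1 : iIndepFun (fun k ω => d k * X k ω) P :=
        hind.comp (fun k x => d k * x) fun k => measurable_const_mul _
      have h2 := h1.indepFun_finsetSum_of_notMem hm (s := Finset.range n) (i := n) (by simp)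
      refine h2.congr (ae_of_all _ fun ω => ?_) (ae_of_all _ fun ω => rfl)
      simp
    · have h1 := h (d n)⁻¹ (inv_pos.2 (hd n))
      rw [Real.inv_rpow (hd n).le, Real.rpow_neg (hd n).le, inv_inv] at h1
      refine h1.congr fun u => ?_
      congr 1
      rw [tail, ← hlaw n, map_measureReal_apply (hX n) measurableSet_Ioi]
      congr 1
      ext ω
      simp [← div_eq_mul_inv, div_lt_iff₀ (hd n), mul_comm]

end TailAsymptotics

/-! ### Ruin along a fixed path of interest rates -/

/-- The discount factor `((1 + x 1) ⋯ (1 + x k))⁻¹` along the path `x` of interest rates. -/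
noncomputable def discount (x : ℕ → ℝ) (k : ℕ) : ℝ := ∏ j ∈ Finset.range k, (1 / (1 + x (j + 1)))

lemma discount_pos {x : ℕ → ℝ} (hx : ∀ k, 0 < 1 + x k) (k : ℕ) : 0 < discount x k :=
  Finset.prod_pos fun _ _ => one_div_pos.2 (hx _)

lemma discount_succ (x : ℕ → ℝ) (k : ℕ) :
    discount x (k + 1) = discount x k * (1 / (1 + x (k + 1))) := Finset.prod_range_succ _ _

lemma discount_congr {x y : ℕ → ℝ} {k : ℕ} (h : ∀ j ≤ k, x j = y j) :
    discount x k = discount y k :=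
  Finset.prod_congr rfl fun j hj => by rw [h (j + 1) (Finset.mem_range.1 hj)]

lemma discount_mul_surplus {x : ℕ → ℝ} (hx : ∀ k, 0 < 1 + x k) (h : ℝ → ℝ) (c u : ℝ)
    (z : ℕ → ℝ) (k : ℕ) :
    discount x k * surplus h c u x z k =
      u + c * ∑ j ∈ Finset.range k, discount x (j + 1) -
        ∑ j ∈ Finset.range k, discount x (j + 1) * h (z j) := by
  induction k with
  | zero => simp [discount, surplus]
  | succ k ih =>
    have h1 : discount x (k + 1) * (1 + x (k + 1)) = discount x k := by
      rw [discount_succ, mul_assoc, one_div_mul_cancel (hx _).ne', mul_one]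
    rw [Finset.sum_range_succ, Finset.sum_range_succ, surplus]
    linear_combination ih + surplus h c u x z k * h1

lemma surplus_neg_iff {x : ℕ → ℝ} (hx : ∀ k, 0 < 1 + x k) (h : ℝ → ℝ) (c u : ℝ)
    (z : ℕ → ℝ) (k : ℕ) :
    surplus h c u x z k < 0 ↔
      u + c * ∑ j ∈ Finset.range k, discount x (j + 1) <
        ∑ j ∈ Finset.range k, discount x (j + 1) * h (z j) := by
  rw [← sub_neg (b := ∑ j ∈ Finset.range k, discount x (j + 1) * h (z j)),
    ← discount_mul_surplus hx, mul_neg_iff, iff_comm]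
  have := discount_pos hx k
  constructor
  · rintro (⟨-, h⟩ | ⟨h, -⟩)
    exacts [h, absurd h this.not_gt]
  · exact fun h => Or.inl ⟨this, h⟩

lemma surplus_congr {x y : ℕ → ℝ} (h : ℝ → ℝ) (c u : ℝ) (z : ℕ → ℝ) {n : ℕ}
    (hxy : ∀ k ≤ n, x k = y k) : surplus h c u x z n = surplus h c u y z n := by
  induction n with
  | zero => rfl
  | succ n ih =>
    simp only [surplus]
    rw [ih fun k hk => hxy k (hk.trans n.le_succ), hxy _ le_rfl]

lemma measurable_surplus {h : ℝ → ℝ} (hh : Measurable h) (c u : ℝ) (x : ℕ → ℝ) (k : ℕ) :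
    Measurable fun z : ℕ → ℝ => surplus h c u x z k := by
  induction k with
  | zero => exact measurable_const
  | succ k ih =>
    simp only [surplus]
    exact ((ih.mul_const _).add_const _).sub (hh.comp (measurable_pi_apply k))

/-- The loss sequences that lead to ruin in at most `n` periods along the path `x` of interest
rates. -/
def ruinSet (h : ℝ → ℝ) (c u : ℝ) (x : ℕ → ℝ) (n : ℕ) : Set (ℕ → ℝ) :=
  {z | ∃ k, 1 ≤ k ∧ k ≤ n ∧ surplus h c u x z k < 0}

lemma measurableSet_ruinSet {h : ℝ → ℝ} (hh : Measurable h) (c u : ℝ) (x : ℕ → ℝ) (n : ℕ) :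
    MeasurableSet (ruinSet h c u x n) := by
  have : ruinSet h c u x n = ⋃ k ∈ Set.Icc 1 n, {z | surplus h c u x z k < 0} := by
    ext z
    simp [ruinSet, and_assoc]
  rw [this]
  exact MeasurableSet.biUnion (Set.to_countable _) fun k _ =>
    measurableSet_lt (measurable_surplus hh c u x k) measurable_const

lemma ruinSet_congr {x y : ℕ → ℝ} (h : ℝ → ℝ) (c u : ℝ) {n : ℕ}
    (hxy : ∀ k ≤ n, x k = y k) : ruinSet h c u x n = ruinSet h c u y n := by
  ext z
  refine exists_congr fun k => and_congr_right fun _ => and_congr_right fun hk => ?_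
  rw [surplus_congr h c u z fun j hj => hxy j (hj.trans hk)]

section RuinAsymptotics

variable {Ω : Type*} [MeasurableSpace Ω] {P : Measure Ω} [IsProbabilityMeasure P]

/-- The discounted premiums are bounded, and a bounded shift of the initial capital does not
matter; up to it, ruin means that the total discounted loss exceeds the initial capital. -/
lemma tendsto_ruinSet {W : Measure ℝ} {Z : ℕ → Ω → ℝ} {α b : ℝ} (hZ : IsLossSequence P W Z)
    (hb : 0 < b) (hW : HasRegularlyVaryingTail W α) {x : ℕ → ℝ} (hx : ∀ k, 0 < 1 + x k)
    (c : ℝ) (n : ℕ) :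
    Tendsto (fun u => P.real {ω | (fun m => Z m ω) ∈ ruinSet (proportional b) c u x n} /
        tail (W.map (proportional b)) u) atTop
      (𝓝 (∑ k ∈ Finset.range n, discount x (k + 1) ^ α)) := by
  have hmeas : Measurable (proportional b) := measurable_const_mul b
  have : IsProbabilityMeasure W :=
    hZ.law 0 ▸ Measure.isProbabilityMeasure_map (hZ.measurable 0).aemeasurable
  have : IsProbabilityMeasure (W.map (proportional b)) :=
    Measure.isProbabilityMeasure_map hmeas.aemeasurable
  have hV := hW.map_proportional hb
  have hX0 : ∀ k, ∀ᵐ ω ∂P, 0 ≤ proportional b (Z k ω) := fun k => by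
    filter_upwards [hZ.nonneg k] with ω hω using mul_nonneg hb.le hω
  have hd : ∀ k, 0 < discount x (k + 1) := fun k => discount_pos hx _
  have hsum := hV.tendsto_sum (P := P) (X := fun k ω => proportional b (Z k ω))
    (d := fun k => discount x (k + 1))
    (fun k => hmeas.comp (hZ.measurable k)) hX0
    (fun k => by rw [← hZ.law k, Measure.map_map hmeas (hZ.measurable k)]; rfl)
    (hZ.indep.comp (fun _ => proportional b) fun _ => hmeas) hd n
  set D := ∑ j ∈ Finset.range n, discount x (j + 1)
  have hD : ∀ k ≤ n, ∑ j ∈ Finset.range k, discount x (j + 1) ≤ D := fun k hk =>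
    Finset.sum_le_sum_of_subset_of_nonneg (Finset.range_mono hk) fun _ _ _ => (hd _).le
  refine tendsto_of_tendsto_of_tendsto_of_le_of_le' (hV.tendsto_shift hsum (|c| * D))
    (hV.tendsto_shift hsum (-(|c| * D))) ?_ ?_
  · filter_upwards [eventually_ge_atTop 0] with u hu
    refine div_le_div_of_nonneg_right (measureReal_mono fun ω hω => ?_) (hV.tail_pos u).le
    have hω' : u + |c| * D < ∑ k ∈ Finset.range n, discount x (k + 1) * proportional b (Z k ω) := hω
    have h0 : 0 ≤ D := Finset.sum_nonneg fun _ _ => (hd _).le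
    have h1 : c * D ≤ |c| * D := mul_le_mul_of_nonneg_right (le_abs_self c) h0
    have hn : 1 ≤ n := by
      rcases Nat.eq_zero_or_pos n with rfl | hn
      · rw [Finset.sum_range_zero] at hω'
        have := mul_nonneg (abs_nonneg c) h0
        linarith
      · exact hn
    exact ⟨n, hn, le_rfl, (surplus_neg_iff hx _ _ _ _ _).2 (by linarith)⟩
  · refine Eventually.of_forall fun u => ?_
    refine div_le_div_of_nonneg_right (ENNReal.toReal_mono (measure_ne_top _ _)
      (measure_mono_ae ?_)) (hV.tail_pos u).le
    filter_upwards [ae_all_iff.2 hX0] with ω hω hr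
    obtain ⟨k, -, hkn, hk⟩ := hr
    rw [surplus_neg_iff hx] at hk
    have h0 : 0 ≤ ∑ j ∈ Finset.range k, discount x (j + 1) :=
      Finset.sum_nonneg fun _ _ => (hd _).le
    have h1 : -(|c| * D) ≤ c * ∑ j ∈ Finset.range k, discount x (j + 1) := by
      have := mul_le_mul_of_nonneg_right (neg_abs_le c) h0
      have := mul_le_mul_of_nonneg_left (hD k hkn) (abs_nonneg c)
      linarith
    have h2 : ∑ j ∈ Finset.range k, discount x (j + 1) * proportional b (Z j ω) ≤
        ∑ j ∈ Finset.range n, discount x (j + 1) * proportional b (Z j ω) :=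
      Finset.sum_le_sum_of_subset_of_nonneg (Finset.range_mono hkn)
        fun j _ _ => mul_nonneg (hd _).le (hω j)
    change u + -(|c| * D) < ∑ j ∈ Finset.range n, discount x (j + 1) * proportional b (Z j ω)
    linarith

/-! ### Averaging over the paths of the Markov chain -/

/-- The event that the path of interest rates starts with `i (s 0), …, i (s m)`. -/
def pathEvent {l : ℕ} (i : Fin l → ℝ) (I : ℕ → Ω → ℝ) (s : ℕ → Fin l) (m : ℕ) : Set Ω :=
  {ω | ∀ k ≤ m, I k ω = i (s k)}

lemma measurableSet_pathEvent {l : ℕ} {i : Fin l → ℝ} {I : ℕ → Ω → ℝ}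
    (hI : ∀ n, Measurable (I n)) (s : ℕ → Fin l) (m : ℕ) :
    MeasurableSet (pathEvent i I s m) := by
  have : pathEvent i I s m = ⋂ k ∈ Set.Iic m, {ω | I k ω = i (s k)} := by
    ext ω
    simp [pathEvent]
  rw [this]
  exact MeasurableSet.biInter (Set.to_countable _) fun k _ =>
    measurableSet_eq_fun (hI k) measurable_const

omit [MeasurableSpace Ω] in
lemma mem_pathEvent_update {l : ℕ} {i : Fin l → ℝ} {I : ℕ → Ω → ℝ} {s : ℕ → Fin l} {m : ℕ}
    {t : Fin l} {ω : Ω} :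
    ω ∈ pathEvent i I (Function.update s (m + 1) t) (m + 1) ↔
      ω ∈ pathEvent i I s m ∧ I (m + 1) ω = i t := by
  constructor
  · intro h
    refine ⟨fun k hk => ?_, by simpa using h (m + 1) le_rfl⟩
    simpa [Function.update_of_ne (show k ≠ m + 1 by omega)] using h k (by omega)
  · rintro ⟨h, ht⟩ k hk
    rcases eq_or_ne k (m + 1) with rfl | hne
    · simpa using ht
    · simpa [Function.update_of_ne hne] using h k (by omega)

/-- Conditioning on the next state of the chain. -/
lemma measureReal_pathEvent_inter {l : ℕ} {i : Fin l → ℝ} {p : Fin l → Fin l → ℝ} {I : ℕ → Ω → ℝ}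
    (hI : IsMarkovChain P i p I) (s : ℕ → Fin l) (m : ℕ) (A : Set Ω) :
    P.real (pathEvent i I s m ∩ A) =
      ∑ t, P.real (pathEvent i I (Function.update s (m + 1) t) (m + 1) ∩ A) := by
  have hE : ∀ t, MeasurableSet {ω | I (m + 1) ω = i t} := fun t =>
    measurableSet_eq_fun (hI.measurable _) measurable_const
  have h1 : ∀ t, pathEvent i I (Function.update s (m + 1) t) (m + 1) ∩ A =
      {ω | I (m + 1) ω = i t} ∩ (pathEvent i I s m ∩ A) := fun t => by
    ext ω
    simp only [mem_inter_iff, mem_pathEvent_update, mem_ofPred_eq]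
    tauto
  have h2 : ∀ t, P.real ({ω | I (m + 1) ω = i t} ∩ (pathEvent i I s m ∩ A)) =
      (P.restrict (pathEvent i I s m ∩ A)).real {ω | I (m + 1) ω = i t} := fun t => by
    rw [measureReal_restrict_apply (hE t)]
  simp only [h1, h2]
  rw [← measureReal_biUnion_finset (fun t _ t' _ htt' => ?_) fun t _ => hE t]
  · rw [← measureReal_restrict_apply_univ]
    refine measureReal_congr (Filter.EventuallyEq.symm ?_)
    filter_upwards [ae_restrict_of_ae (hI.mem_range (m + 1))] with ω hω
    obtain ⟨t, ht⟩ := hω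
    refine propext ⟨fun _ => trivial, fun _ => ?_⟩
    exact mem_biUnion (Finset.mem_univ t) ht.symm
  · refine Set.disjoint_left.2 fun ω h h' => htt' (hI.injective ?_)
    exact Eq.trans (Eq.symm h) h'

/-- The ruin probability within `m + r` periods on the event that the states up to time `m`
are known: the first sum comes from the losses up to time `m`, the other term from the later ones.
The constant `asympConst` is built up backwards, by forgetting the last known rate. -/
lemma tendsto_pathEvent_inter_ruinSet {l : ℕ} {i : Fin l → ℝ} {p : Fin l → Fin l → ℝ}
    {I Z : ℕ → Ω → ℝ} {W : Measure ℝ} {α b : ℝ} (hI : IsMarkovChain P i p I)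
    (hZ : IsLossSequence P W Z)
    (hIZ : IndepFun (fun ω n => I n ω) (fun ω n => Z n ω) P)
    (hb : 0 < b) (hW : HasRegularlyVaryingTail W α) (hi : ∀ t, 0 < 1 + i t) (c : ℝ)
    (r m : ℕ) (s : ℕ → Fin l) :
    Tendsto (fun u => P.real (pathEvent i I s m ∩
        {ω | (fun k => Z k ω) ∈ ruinSet (proportional b) c u (fun k => I k ω) (m + r)}) /
          tail (W.map (proportional b)) u) atTop
      (𝓝 (P.real (pathEvent i I s m) *
        (∑ k ∈ Finset.range m, discount (i ∘ s) (k + 1) ^ α +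
          discount (i ∘ s) m ^ α * asympConst i p α r (s m)))) := by
  induction r generalizing m s with
  | zero =>
    have hlim := (tendsto_ruinSet hZ hb hW (x := i ∘ s) (fun k => hi _) c m).const_mul
      (P.real (pathEvent i I s m))
    simp only [asympConst, mul_zero, add_zero]
    refine hlim.congr fun u => ?_
    rw [← mul_div_assoc]
    congr 1
    have hset : pathEvent i I s m ∩
        {ω | (fun k => Z k ω) ∈ ruinSet (proportional b) c u (fun k => I k ω) m} =
        (fun ω n => I n ω) ⁻¹' pathEvent i (fun k x => x k) s m ∩
          (fun ω n => Z n ω) ⁻¹' ruinSet (proportional b) c u (i ∘ s) m := by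
      ext ω
      refine and_congr_right fun hω => ?_
      rw [mem_ofPred_eq, ruinSet_congr (proportional b) c u (y := i ∘ s) hω]
      rfl
    rw [hset]
    have hprod := hIZ.measure_inter_preimage_eq_mul _ _
      (measurableSet_pathEvent (i := i) (I := fun k (x : ℕ → ℝ) => x k) measurable_pi_apply s m)
      (measurableSet_ruinSet (h := proportional b) (measurable_const_mul b) c u (i ∘ s) m)
    rw [measureReal_def P (_ ∩ _), hprod, ENNReal.toReal_mul]
    rfl
  | succ r ih =>
    have hlim := tendsto_finsetSum Finset.univ
      fun t _ => ih (m + 1) (Function.update s (m + 1) t)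
    have hval : ∑ t, P.real (pathEvent i I (Function.update s (m + 1) t) (m + 1)) *
        (∑ k ∈ Finset.range (m + 1), discount (i ∘ Function.update s (m + 1) t) (k + 1) ^ α +
          discount (i ∘ Function.update s (m + 1) t) (m + 1) ^ α *
            asympConst i p α r (Function.update s (m + 1) t (m + 1))) =
        P.real (pathEvent i I s m) *
        (∑ k ∈ Finset.range m, discount (i ∘ s) (k + 1) ^ α +
          discount (i ∘ s) m ^ α * asympConst i p α (r + 1) (s m)) := by
      set S := ∑ k ∈ Finset.range m, discount (i ∘ s) (k + 1) ^ α
      have hd : ∀ t, ∀ k ≤ m, discount (i ∘ Function.update s (m + 1) t) k =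
          discount (i ∘ s) k := fun t k hk => discount_congr fun j hj => by
        simp [Function.update_of_ne (show j ≠ m + 1 by omega)]
      have hterm : ∀ t, P.real (pathEvent i I (Function.update s (m + 1) t) (m + 1)) *
          (∑ k ∈ Finset.range (m + 1), discount (i ∘ Function.update s (m + 1) t) (k + 1) ^ α +
            discount (i ∘ Function.update s (m + 1) t) (m + 1) ^ α *
              asympConst i p α r (Function.update s (m + 1) t (m + 1))) =
          P.real (pathEvent i I s m) * S * p (s m) t +
          P.real (pathEvent i I s m) * discount (i ∘ s) m ^ α *
            (p (s m) t * ((1 + asympConst i p α r t) * (1 / (1 + i t)) ^ α)) := fun t => by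
        have h1 : P.real (pathEvent i I (Function.update s (m + 1) t) (m + 1)) =
            P.real (pathEvent i I s m) * p (s m) t := by
          have h2 := hI.markov m (Function.update s (m + 1) t)
          have h3 : pathEvent i I (Function.update s (m + 1) t) m = pathEvent i I s m := by
            ext ω
            refine forall₂_congr fun k hk => ?_
            rw [Function.update_of_ne (show k ≠ m + 1 by omega)]
          rw [Function.update_of_ne (show m ≠ m + 1 by omega), Function.update_self] at h2
          rw [← h3]
          exact h2
        have h4 : ∑ k ∈ Finset.range m, discount (i ∘ Function.update s (m + 1) t) (k + 1) ^ α =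
            S := Finset.sum_congr rfl fun k hk => by rw [hd t (k + 1) (Finset.mem_range.1 hk)]
        have h5 : discount (i ∘ Function.update s (m + 1) t) (m + 1) ^ α =
            discount (i ∘ s) m ^ α * (1 / (1 + i t)) ^ α := by
          rw [discount_succ, hd t m le_rfl, Function.comp_apply, Function.update_self,
            Real.mul_rpow (discount_pos (x := i ∘ s) (fun k => hi _) m).le (one_div_pos.2 (hi t)).le]
        rw [h1, Finset.sum_range_succ, h4, h5, Function.update_self]
        ring
      rw [Finset.sum_congr rfl fun t _ => hterm t, Finset.sum_add_distrib, ← Finset.mul_sum,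
        ← Finset.mul_sum, hI.sum_eq_one, asympConst]
      ring
    rw [hval] at hlim
    refine hlim.congr fun u => ?_
    rw [measureReal_pathEvent_inter hI s m, Finset.sum_div]
    simp only [Nat.add_assoc, Nat.add_comm 1 r]

end RuinAsymptotics

lemma asympConst_nonneg {l : ℕ} {i : Fin l → ℝ} {p : Fin l → Fin l → ℝ}
    (hp : ∀ s t, 0 ≤ p s t) (hi : ∀ t, 0 < 1 + i t) (α : ℝ) (n : ℕ) (s : Fin l) :
    0 ≤ asympConst i p α n s := by
  induction n generalizing s with
  | zero => exact le_rfl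
  | succ n ih =>
    exact Finset.sum_nonneg fun t _ => mul_nonneg (hp s t) (mul_nonneg
      (add_nonneg zero_le_one (ih t)) (Real.rpow_nonneg (one_div_pos.2 (hi t)).le _))

lemma asympConst_succ_pos {l : ℕ} {i : Fin l → ℝ} {p : Fin l → Fin l → ℝ}
    (hp : ∀ s t, 0 ≤ p s t) (hp1 : ∀ s, ∑ t, p s t = 1) (hi : ∀ t, 0 < 1 + i t) (α : ℝ) (n : ℕ)
    (s : Fin l) : 0 < asympConst i p α (n + 1) s := by
  have hq : ∀ t, 0 < (1 + asympConst i p α n t) * (1 / (1 + i t)) ^ α := fun t =>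
    mul_pos (add_pos_of_pos_of_nonneg one_pos (asympConst_nonneg hp hi α n t))
      (Real.rpow_pos_of_pos (one_div_pos.2 (hi t)) _)
  obtain ⟨t, -, ht⟩ : ∃ t ∈ Finset.univ, p s t ≠ 0 :=
    Finset.exists_ne_zero_of_sum_ne_zero (by rw [hp1 s]; exact one_ne_zero)
  exact Finset.sum_pos' (fun t _ => mul_nonneg (hp s t) (hq t).le)
    ⟨t, Finset.mem_univ t, mul_pos ((hp s t).lt_of_ne' ht) (hq t)⟩

end RiskProcess

theorem theorem3 {Ω : Type*} [MeasurableSpace Ω] (P : Measure Ω) [IsProbabilityMeasure P]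
    {l : ℕ} (i : Fin l → ℝ) (p : Fin l → Fin l → ℝ) (I Z : ℕ → Ω → ℝ)
    (W : Measure ℝ) (α b θ η : ℝ)
    (hI : RiskProcess.IsMarkovChain P i p I)
    (hZ : RiskProcess.IsLossSequence P W Z)
    -- the losses are independent of the interest rates
    (hIZ : IndepFun (fun ω n => I n ω) (fun ω n => Z n ω) P)
    -- the mean loss, on which the premium is based, is finite
    (hmean : Integrable (fun z : ℝ => z) W)
    (hb0 : 0 < b) (hb1 : b ≤ 1)
    (hα : 0 < α) (hW : RiskProcess.HasRegularlyVaryingTail W α)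
    (hi : ∀ t, 0 < 1 + i t) :
    ∀ (n : ℕ) (s : Fin l), P {ω | I 0 ω = i s} ≠ 0 →
      Asymptotics.IsEquivalent atTop
        (fun u : ℝ => RiskProcess.ruinProb P I Z (RiskProcess.proportional b)
          (RiskProcess.retainedPremium θ η (RiskProcess.proportional b) W) n u (i s))
        (fun u : ℝ => RiskProcess.asympConst i p α n s *
          RiskProcess.tail (W.map (RiskProcess.proportional b)) u) := by
  intro n s hs
  have hmeas : Measurable (RiskProcess.proportional b) := measurable_const_mul b
  have : IsProbabilityMeasure W :=
    hZ.law 0 ▸ Measure.isProbabilityMeasure_map (hZ.measurable 0).aemeasurable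
  have : IsProbabilityMeasure (W.map (RiskProcess.proportional b)) :=
    Measure.isProbabilityMeasure_map hmeas.aemeasurable
  set c := RiskProcess.retainedPremium θ η (RiskProcess.proportional b) W
  have hpos := (hW.map_proportional hb0).tail_pos
  cases n with
  | zero =>
    have h0 : ∀ u, RiskProcess.ruinProb P I Z (RiskProcess.proportional b) c 0 u (i s) = 0 := by
      intro u
      have : {ω | ∃ k, 1 ≤ k ∧ k ≤ 0 ∧ RiskProcess.surplus (RiskProcess.proportional b) c u
          (fun m => I m ω) (fun m => Z m ω) k < 0} = ∅ :=
        Set.eq_empty_of_forall_notMem fun ω ⟨k, h1, h2, _⟩ => by omega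
      rw [RiskProcess.ruinProb, this, measureReal_empty]
    simp only [h0, RiskProcess.asympConst, zero_mul]
    exact Asymptotics.IsEquivalent.refl
  | succ n =>
    have hpath : RiskProcess.pathEvent i I (fun _ => s) 0 = {ω | I 0 ω = i s} := by
      ext ω
      simp [RiskProcess.pathEvent]
    have hlim := RiskProcess.tendsto_pathEvent_inter_ruinSet hI hZ hIZ hb0 hW hi c (n + 1) 0
      fun _ => s
    have hP : P.real {ω | I 0 ω = i s} ≠ 0 := (measureReal_ne_zero_iff).2 hs
    have hc := RiskProcess.asympConst_succ_pos hI.nonneg hI.sum_eq_one hi α n s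
    rw [hpath] at hlim
    have hlim' := hlim.const_mul (P.real {ω | I 0 ω = i s} *
      RiskProcess.asympConst i p α (n + 1) s)⁻¹
    refine Asymptotics.isEquivalent_of_tendsto_one ?_
    have h1 : (P.real {ω | I 0 ω = i s} * RiskProcess.asympConst i p α (n + 1) s)⁻¹ *
        (P.real {ω | I 0 ω = i s} * (∑ k ∈ Finset.range 0,
          RiskProcess.discount (i ∘ fun _ => s) (k + 1) ^ α +
          RiskProcess.discount (i ∘ fun _ => s) 0 ^ α *
            RiskProcess.asympConst i p α (n + 1) s)) = 1 := by
      simp only [Finset.sum_range_zero, RiskProcess.discount, Finset.prod_range_zero,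
        Real.one_rpow, one_mul, zero_add]
      exact inv_mul_cancel₀ (mul_ne_zero hP hc.ne')
    rw [h1] at hlim'
    refine hlim'.congr fun u => ?_
    rw [zero_add, Pi.div_apply, RiskProcess.ruinProb, measureReal_def (P[|{ω | I 0 ω = i s}]),
      cond_apply (measurableSet_eq_fun (hI.measurable 0) measurable_const),
      ENNReal.toReal_mul, ENNReal.toReal_inv, mul_inv, div_eq_mul_inv, div_eq_mul_inv, mul_inv]
    simp only [measureReal_def, RiskProcess.ruinSet, Set.mem_ofPred_eq]
    ring
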